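/- A sequence over an abelian group $G$ (written additively) is a finite multiset $S$ of elements of $G$. Write $|S|$ for its length (number of terms counted with multiplicity), $\nu_S(a)$ for the multiplicity of $a$ in $S$, and $\Sigma(S)$ for the set of sums of all subsequences of $S$, including the empty one. $S$ is zero-sum-free if no nonempty subsequence of $S$ has sum $0$. Let $h_k(S)$ be the $k$-th largest multiplicity of a term of $S$ (multiplicities of distinct terms are listed in non-increasing order, with repetitions), with $h_k(S)=0$ if $S$ has fewer than $k$ distinct terms. An ordered pair $(a,b)$ of distinct terms of $S$ is unstable if there are positive integers $u\le \nu_S(a)+1$ and $v\le\nu_S(b)-1$ with $ua=vb$ and either $u>v$, or $u=v>\nu_S(b)-\nu_S(a)$ (the transfer operation then replaces the multiplicities of $a$ and $b$ by $\nu_S(a)+u$ and $\nu_S(b)-v$); $S$ is stable if no ordered pair of distinct terms of $S$ is unstable. Lemma. Let $C\ge 2$ be an integer, and let $S$ be a zero-sum-free sequence over an abelian group with $n:=|S|\ge 2$. Put $h_1:=h_1(S)$ and $h_2:=h_2(S)$. If $|\Sigma(S)|<Cn$, then $$ h_1 > \frac{n^2}{6|\Sigma(S)|} > \frac{n}{6C},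 $$ and, if $S$ has at least two distinct terms, $$ h_1 > n-\sqrt{6h_2|\Sigma(S)|}+h_2 > n-\sqrt{6Cnh_2}+h_2. $$ If, moreover, $S$ is stable, $n\ge(4C)^3$, and $|\Sigma(S)|<Cn-C^2\sqrt{6n}$, then $$ h_2\le C-1 \quad\text{and}\quad h_1>n-C\sqrt{6n}+1. $$ -/

import Mathlib

/-!
A (finite) sequence over an abelian group `G` is an element of the free abelian monoid over `G`,
that is, a `Multiset G`; a subsequence of `S` is a multiset `T ≤ S`, the multiplicity of `a` in `S`
is `S.count a`, and the length of `S` is `S.card`.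
-/

namespace GroupSequence

variable {G : Type*} [AddCommGroup G]

/-- The set `Σ(S)` of the sums of all subsequences of `S`, including the empty one. -/
def subsums (S : Multiset G) : Set G :=
  {g | ∃ T : Multiset G, T ≤ S ∧ T.sum = g}

/-- The subsequence sum set is finite, so that `Set.ncard` is its true cardinality. -/
theorem subsums_finite (S : Multiset G) : (subsums S).Finite := by
  classical
  refine ((S.powerset.map Multiset.sum).toFinset.finite_toSet).subset ?_
  rintro g ⟨T, hT, rfl⟩
  simp only [Finset.mem_coe, Multiset.mem_toFinset, Multiset.mem_map, Multiset.mem_powerset]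
  exact ⟨T, hT, rfl⟩

/-- No nonempty subsequence of `S` has zero sum. -/
def ZeroSumFree (S : Multiset G) : Prop :=
  ∀ T : Multiset G, T ≤ S → T ≠ 0 → T.sum ≠ 0

variable [DecidableEq G]

/-- The `k`-th largest multiplicity (`k ≥ 1`) of a term of `S`: the multiplicities of the distinct
terms of `S` are listed in non-increasing order, with repetitions, and the `k`-th entry is taken;
it is `0` if `S` has fewer than `k` distinct terms. -/
def kthMult (k : ℕ) (S : Multiset G) : ℕ :=
  ((S.dedup.map fun a => S.count a).sort (· ≥ ·)).getD (k - 1) 0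

/-- The ordered pair `(a, b)` of distinct terms of `S` is unstable: for some positive integers
`u ≤ ν(a) + 1` and `v ≤ ν(b) - 1` with `u a = v b`, where either `u > v` or `u = v > ν(b) - ν(a)`,
the transfer operation replaces the multiplicities `ν(a)`, `ν(b)` of `a`, `b` in `S` by
`ν(a) + u`, `ν(b) - v`. -/
def UnstablePair (S : Multiset G) (a b : G) : Prop :=
  ∃ u v : ℕ, 0 < u ∧ 0 < v ∧ u ≤ S.count a + 1 ∧ v ≤ S.count b - 1 ∧ u • a = v • b ∧
    (v < u ∨ (u = v ∧ (S.count b : ℤ) - (S.count a : ℤ) < (v : ℤ)))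

/-- `S` is stable: the transfer operation applies to no ordered pair of distinct terms of `S`. -/
def Stable (S : Multiset G) : Prop :=
  ∀ a ∈ S, ∀ b ∈ S, a ≠ b → ¬ UnstablePair S a b

end GroupSequence

/-!
The core is a quadratic bound: a zero-sum-free set of `k` elements has at least `k ^ 2 / 6` nonzero
subset sums (`setBound_lt_card_sumFinset`, `sq_le_setBound`). Since zero is uniquely represented in
the sumset of the sums of two disjoint parts of a zero-sum-free sequence, Scherk's inequality
`#A + #B ≤ #(A + B) + 1` makes the number of nonzero sums superadditive (`card_sumFinset_add`). A
sequence with multiplicities at most `m` splits into `m` sets, so by the Cauchy-Schwarz inequality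
it has at least `n ^ 2 / (6 m)` nonzero sums (`sq_card_le`). With `m = h₁` this is the first bound;
after the removal of `h₁ - h₂` copies of the most frequent term, with `m = h₂`, it is the second.

The quadratic bound for sets follows Olson. Let `B` be the set of sums of the elements chosen so
far and let `P` consist of the `p` remaining ones. Choosing `x ∈ P` gains the elements of
`(x + B) \ B`; their number is subadditive and even in `x`, and its total over any set `K` is at
least `#B * (#K - #B)`. If `P` generates the group, the multiples of `T = P ∪ -P ∪ {0}` grow by at
least `#T / 2` each time until they cover the group (`two_mul_card_add_card_le`, an isoperimetric
argument with atoms in the sense of Hamidoune). Taking `K` from these multiples shows that some `x`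
gains about `p / 2`, provided that `p ≤ #B` and that `B` fills at most half of the group; smaller
sets grow exponentially (`exists_gain_le`). If one of the provisos fails after a few steps, there
are about twice as many sums as for the remaining elements, and these are still more than
`k / √2` in number, so that induction applies (`lt_card_sumFinset_of_greedy`). Otherwise the gains
of about `k / 4` steps, together with the induction hypothesis for the remaining elements, are
sufficient (by estimates of the gains for large `k`, and by evaluation for small `k`).

For a stable sequence in which `a` and `b` have the multiplicities `h₁ ≥ h₂`, all sums `i a + j b`
with `i ≤ h₁` and `j < h₂` are distinct, which gives at least `(h₂ - 1) h₁ + n + 1` sums in total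
(`Stable.le_card_sumFinset`). Together with the two bounds above this forces `h₂ < C`
(`lt_of_card_bounds`), and the lower bound for `h₁` follows from the second bound.
-/

namespace GroupSequence

open scoped Pointwise
open Finset

variable {G : Type*} [AddCommGroup G] [DecidableEq G]

/-! ### Sumsets in which zero is uniquely represented -/

/-- Scherk's bound. The proof transfers elements from `B` to `A` by the Dyson transform at some
`a ∈ A` with `a + b ∉ A`, which preserves `#A + #B` and the uniqueness of the representation. -/
theorem card_add_card_le_of_unique_zero {A B : Finset G} (hA : 0 ∈ A) (hB : 0 ∈ B)
    (h : ∀ a ∈ A, ∀ b ∈ B, a + b = 0 → b = 0) : #A + #B ≤ #(A + B) + 1 := by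
  induction hn : #B using Nat.strong_induction_on generalizing A B with
  | _ n ih =>
    by_cases hB' : ∃ b ∈ B, b ≠ 0
    · obtain ⟨b, hb, hb0⟩ := hB'
      obtain ⟨a, ha, hab⟩ : ∃ a ∈ A, a + b ∉ A := by
        by_contra! hcon
        have hsub : A.image (· + b) ⊆ A := by
          intro x hx
          obtain ⟨a, ha, rfl⟩ := mem_image.1 hx
          exact hcon a ha
        have heq := eq_of_subset_of_card_le hsub
          (card_image_of_injective _ (add_left_injective b)).ge
        rw [← heq] at hA
        obtain ⟨a, ha, hab⟩ := mem_image.1 hA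
        exact hb0 (h a ha b hb hab)
      set B₁ := B.filter fun x => a + x ∈ A with hB₁
      set B₂ := B.filter fun x => a + x ∉ A with hB₂
      have hcard : #B₁ + #B₂ = #B := card_filter_add_card_filter_not _
      have hdisj : Disjoint A (B₂.image (a + ·)) := by
        rw [disjoint_left]
        intro x hx hx'
        obtain ⟨y, hy, rfl⟩ := mem_image.1 hx'
        exact (mem_filter.1 hy).2 hx
      have hA₁ : #(A ∪ B₂.image (a + ·)) = #A + #B₂ := by
        rw [card_union_of_disjoint hdisj, card_image_of_injective _ (add_right_injective a)]
      have hlt : #B₁ < n := by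
        have : 0 < #B₂ := card_pos.2 ⟨b, mem_filter.2 ⟨hb, hab⟩⟩
        omega
      have := ih #B₁ hlt (A := A ∪ B₂.image (a + ·)) (B := B₁) (mem_union_left _ hA)
        (mem_filter.2 ⟨hB, by simpa using ha⟩) (by
          intro x hx y hy hxy
          obtain ⟨hyB, hyA⟩ := mem_filter.1 hy
          rcases mem_union.1 hx with hx | hx
          · exact h x hx y hyB hxy
          · obtain ⟨c, hc, rfl⟩ := mem_image.1 hx
            have hc' := mem_filter.1 hc
            have hc0 : c = 0 := h _ hyA c hc'.1 (by rw [← hxy]; abel)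
            exact absurd (by simpa [hc0] using ha) hc'.2) rfl
      have hsub : (A ∪ B₂.image (a + ·)) + B₁ ⊆ A + B := by
        intro z hz
        obtain ⟨x, hx, y, hy, rfl⟩ := mem_add.1 hz
        obtain ⟨hyB, hyA⟩ := mem_filter.1 hy
        rcases mem_union.1 hx with hx | hx
        · exact add_mem_add hx hyB
        · obtain ⟨c, hc, rfl⟩ := mem_image.1 hx
          exact mem_add.2 ⟨a + y, hyA, c, (mem_filter.1 hc).1, by abel⟩
      have := card_le_card hsub
      omega
    · push Not at hB'
      have : B = {0} := by
        ext x; simp only [mem_singleton]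
        exact ⟨hB' x, fun hx => hx ▸ hB⟩
      subst this
      simp at hn ⊢
      omega

/-! ### Subsequence sums -/

/-- The set of all subsequence sums as a `Finset`. -/
def sumFinset (S : Multiset G) : Finset G := (S.powerset.map Multiset.sum).toFinset

theorem mem_sumFinset {S : Multiset G} {g : G} : g ∈ sumFinset S ↔ ∃ T ≤ S, T.sum = g := by
  simp [sumFinset]

theorem ncard_subsums (S : Multiset G) : (subsums S).ncard = #(sumFinset S) := by
  rw [← Set.ncard_coe_finset]
  congr 1
  ext g
  simp [mem_sumFinset, subsums]

theorem zero_mem_sumFinset (S : Multiset G) : 0 ∈ sumFinset S :=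
  mem_sumFinset.2 ⟨0, Multiset.zero_le _, rfl⟩

theorem card_sumFinset_pos (S : Multiset G) : 0 < #(sumFinset S) :=
  card_pos.2 ⟨0, zero_mem_sumFinset S⟩

theorem sumFinset_add (S T : Multiset G) : sumFinset (S + T) = sumFinset S + sumFinset T := by
  ext g
  rw [mem_add]
  constructor
  · intro hg
    obtain ⟨U, hU, rfl⟩ := mem_sumFinset.1 hg
    refine ⟨(U ∩ S).sum, mem_sumFinset.2 ⟨_, Multiset.inter_le_right, rfl⟩, (U - S).sum,
      mem_sumFinset.2 ⟨_, ?_, rfl⟩, ?_⟩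
    · exact tsub_le_iff_left.2 hU
    · rw [← Multiset.sum_add]
      congr 1
      ext a
      simp only [Multiset.count_add, Multiset.count_inter, Multiset.count_sub]
      omega
  · rintro ⟨x, hx, y, hy, rfl⟩
    obtain ⟨U, hU, rfl⟩ := mem_sumFinset.1 hx
    obtain ⟨V, hV, rfl⟩ := mem_sumFinset.1 hy
    exact mem_sumFinset.2 ⟨U + V, add_le_add hU hV, Multiset.sum_add _ _⟩

theorem sumFinset_singleton (a : G) : sumFinset ({a} : Multiset G) = {0, a} := by
  ext g
  simp only [mem_sumFinset, mem_insert, mem_singleton]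
  constructor
  · rintro ⟨T, hT, rfl⟩
    rcases Multiset.le_singleton.1 hT with rfl | rfl <;> simp
  · rintro (rfl | rfl)
    · exact ⟨0, by simp, by simp⟩
    · exact ⟨{g}, le_rfl, by simp⟩

theorem sumFinset_mono {S T : Multiset G} (h : S ≤ T) : sumFinset S ⊆ sumFinset T := fun g hg => by
  obtain ⟨U, hU, rfl⟩ := mem_sumFinset.1 hg
  exact mem_sumFinset.2 ⟨U, hU.trans h, rfl⟩

theorem ZeroSumFree.mono {G : Type*} [AddCommGroup G] {S T : Multiset G} (hT : ZeroSumFree T)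
    (h : S ≤ T) : ZeroSumFree S :=
  fun U hU => hT U (hU.trans h)

/-- If two disjoint parts of a zero-sum-free sequence have opposite sums, both are empty. -/
theorem ZeroSumFree.eq_zero_of_add {S T : Multiset G} (h : ZeroSumFree (S + T)) {x y : G}
    (hx : x ∈ sumFinset S) (hy : y ∈ sumFinset T) (hxy : x + y = 0) : y = 0 := by
  obtain ⟨U, hU, rfl⟩ := mem_sumFinset.1 hx
  obtain ⟨V, hV, rfl⟩ := mem_sumFinset.1 hy
  by_contra hne
  refine h (U + V) (add_le_add hU hV) ?_ (by rw [Multiset.sum_add, hxy])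
  intro h0
  have : V = 0 := (add_eq_zero.1 h0).2
  simp [this] at hne

theorem card_sumFinset_add {S T : Multiset G} (h : ZeroSumFree (S + T)) :
    #(sumFinset S) + #(sumFinset T) ≤ #(sumFinset (S + T)) + 1 := by
  rw [sumFinset_add]
  exact card_add_card_le_of_unique_zero (zero_mem_sumFinset S) (zero_mem_sumFinset T)
    fun x hx y hy => h.eq_zero_of_add hx hy

theorem ZeroSumFree.zero_notMem {G : Type*} [AddCommGroup G] {S : Multiset G}
    (h : ZeroSumFree S) : (0 : G) ∉ S := fun h0 =>
  h {0} (Multiset.singleton_le.2 h0) (by simp) (by simp)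

theorem card_lt_card_sumFinset {S : Multiset G} (h : ZeroSumFree S) :
    S.card + 1 ≤ #(sumFinset S) := by
  induction S using Multiset.induction with
  | empty => simpa using card_sumFinset_pos (0 : Multiset G)
  | cons a S ih =>
    rw [← Multiset.singleton_add] at h ⊢
    have h1 := card_sumFinset_add h
    have h2 := ih (h.mono (Multiset.le_add_left _ _))
    have h3 : #(sumFinset ({a} : Multiset G)) = 2 := by
      rw [sumFinset_singleton, card_pair]
      rintro rfl
      exact h.zero_notMem (by simp)
    simp only [Multiset.card_add, Multiset.card_singleton]
    omega

/-! ### Growth of sumsets of a symmetric generating set -/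

/-- An isoperimetric inequality. Among the sets `X` with `X + T ≠ G` and `#(X + T) - #X` minimal,
one of least size meets each of its translates trivially (submodularity), so it is a coset of a
proper subgroup `D`; then `X + T` is a union of at least two cosets of `D`. -/
theorem two_mul_card_add_card_le {T : Finset G} (h0 : 0 ∈ T) (hneg : ∀ x ∈ T, -x ∈ T)
    (hgen : AddSubgroup.closure (T : Set G) = ⊤) {X : Finset G} (hX : X.Nonempty)
    (hXT : ∃ g, g ∉ X + T) : 2 * #X + #T ≤ 2 * #(X + T) := by
  have hle : ∀ Y : Finset G, Y ⊆ Y + T := fun Y y hy => mem_add.2 ⟨y, hy, 0, h0, add_zero y⟩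
  have hcle : ∀ Y : Finset G, #Y ≤ #(Y + T) := fun Y => card_le_card (hle Y)
  obtain ⟨M, ⟨hM, hMT⟩, hmin, hmin'⟩ : ∃ M : Finset G, (M.Nonempty ∧ ∃ g, g ∉ M + T) ∧
      (∀ Y : Finset G, Y.Nonempty → (∃ g, g ∉ Y + T) → #(M + T) - #M ≤ #(Y + T) - #Y) ∧
      (∀ Y : Finset G, Y.Nonempty → (∃ g, g ∉ Y + T) → #(Y + T) - #Y ≤ #(M + T) - #M →
        #M ≤ #Y) := by
    obtain ⟨M, hM, hmin⟩ := WellFounded.has_min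
      (InvImage.wf (fun Y : Finset G => toLex (#(Y + T) - #Y, #Y)) wellFounded_lt)
      {Y : Finset G | Y.Nonempty ∧ ∃ g, g ∉ Y + T} ⟨X, hX, hXT⟩
    refine ⟨M, hM, fun Y hY hYT => ?_, fun Y hY hYT hYM => ?_⟩
    · have := hmin Y ⟨hY, hYT⟩
      simp only [InvImage, Prod.Lex.toLex_lt_toLex] at this
      omega
    · have := hmin Y ⟨hY, hYT⟩
      simp only [InvImage, Prod.Lex.toLex_lt_toLex] at this
      omega
  have hkey : ∀ g : G, (M ∩ (g +ᵥ M)).Nonempty → g +ᵥ M = M := by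
    intro g hI
    have hcN : #(g +ᵥ M) = #M := card_vadd_finset _ _
    have hNT : (g +ᵥ M) + T = g +ᵥ (M + T) := vadd_add_assoc _ _ _
    have hcNT : #((g +ᵥ M) + T) = #(M + T) := by rw [hNT, card_vadd_finset]
    have hUT : (M ∪ (g +ᵥ M)) + T = (M + T) ∪ ((g +ᵥ M) + T) := union_add
    have hIT : (M ∩ (g +ᵥ M)) + T ⊆ (M + T) ∩ ((g +ᵥ M) + T) := inter_add_subset
    have hIT' := card_le_card hIT
    have e1 := card_union_add_card_inter M (g +ᵥ M)
    have e2 := card_union_add_card_inter (M + T) ((g +ᵥ M) + T)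
    rw [← hUT] at e2
    have hIF : ∃ x, x ∉ (M ∩ (g +ᵥ M)) + T := by
      obtain ⟨x, hx⟩ := hMT
      exact ⟨x, fun h => hx (mem_inter.1 (hIT h)).1⟩
    have hI1 := hmin _ hI hIF
    have hIpos := card_pos.2 hI
    have c1 := hcle M
    have c2 := hcle (M ∩ (g +ᵥ M))
    have c3 := hcle (M ∪ (g +ᵥ M))
    have hUF : ∃ x, x ∉ (M ∪ (g +ᵥ M)) + T := by
      by_contra! hall
      -- The complement of `M + T` is again admissible, by the symmetry of `T`.
      set Y := ((M ∪ (g +ᵥ M)) + T) \ (M + T) with hY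
      have hYne : Y.Nonempty := by
        obtain ⟨x, hx⟩ := hMT
        exact ⟨x, mem_sdiff.2 ⟨hall x, hx⟩⟩
      have hdisj : Disjoint (Y + T) M := by
        rw [disjoint_left]
        intro z hz hzM
        obtain ⟨y, hy, t, ht, rfl⟩ := mem_add.1 hz
        exact (mem_sdiff.1 hy).2 (mem_add.2 ⟨y + t, hzM, -t, hneg t ht, by abel⟩)
      have hYF : ∃ x, x ∉ Y + T := by
        obtain ⟨m, hm⟩ := hM
        exact ⟨m, fun h => disjoint_left.1 hdisj h hm⟩
      have hcY : #Y + #(M + T) = #((M ∪ (g +ᵥ M)) + T) :=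
        card_sdiff_add_card_eq_card (fun x _ => hall x)
      have hcYT : #(Y + T) + #M ≤ #((M ∪ (g +ᵥ M)) + T) := by
        rw [← card_union_of_disjoint hdisj]
        exact card_le_card fun x _ => hall x
      have := hmin' Y hYne hYF (by omega)
      omega
    have hU1 := hmin _ (hM.mono subset_union_left) hUF
    have := hmin' _ hI hIF (by omega)
    have hIM : M ∩ (g +ᵥ M) = M := eq_of_subset_of_card_le inter_subset_left this
    exact (eq_of_subset_of_card_le (inter_eq_left.1 hIM) (by omega)).symm
  obtain ⟨m₀, hm₀⟩ := hM
  obtain ⟨t, ht, htM⟩ : ∃ t ∈ T, t +ᵥ M ≠ M := by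
    by_contra! hall
    have hst : AddSubgroup.closure (T : Set G) ≤ AddAction.stabilizer G M := by
      rw [AddSubgroup.closure_le]
      exact fun t ht => AddAction.mem_stabilizer_iff.2 (hall t ht)
    rw [hgen] at hst
    obtain ⟨x, hx⟩ := hMT
    apply hx
    apply hle
    have h1 : (x - m₀) +ᵥ M = M := AddAction.mem_stabilizer_iff.1 (hst (AddSubgroup.mem_top _))
    rw [← h1]
    exact mem_vadd_finset.2 ⟨m₀, hm₀, by simp⟩
  have hdisj : Disjoint M (t +ᵥ M) := by
    rw [disjoint_iff_inter_eq_empty, ← not_nonempty_iff_eq_empty]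
    exact fun h => htM (hkey t h)
  have h1 : #M + #M ≤ #(M + T) := by
    have : M ∪ (t +ᵥ M) ⊆ M + T := by
      apply union_subset (hle M)
      intro z hz
      obtain ⟨m, hm, rfl⟩ := mem_vadd_finset.1 hz
      exact mem_add.2 ⟨m, hm, t, ht, by simp [add_comm]⟩
    have := card_le_card this
    rwa [card_union_of_disjoint hdisj, card_vadd_finset] at this
  have h2 : #T ≤ #(M + T) := by
    rw [← card_vadd_finset m₀ T]
    apply card_le_card
    intro z hz
    obtain ⟨t, ht, rfl⟩ := mem_vadd_finset.1 hz
    exact mem_add.2 ⟨m₀, hm₀, t, ht, rfl⟩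
  have h3 := hmin X hX hXT
  have := hcle X
  omega

theorem card_nsmul_ge {T : Finset G} (h0 : 0 ∈ T) (hneg : ∀ x ∈ T, -x ∈ T)
    (hgen : AddSubgroup.closure (T : Set G) = ⊤) (m : ℕ) :
    (∀ g, g ∈ (m + 1) • T) ∨ (m + 2) * #T ≤ 2 * #((m + 1) • T) := by
  induction m with
  | zero => right; simp
  | succ m ih =>
    rw [succ_nsmul T (m + 1)]
    by_cases hall : ∀ g, g ∈ (m + 1) • T + T
    · exact Or.inl hall
    · right
      push Not at hall
      rcases ih with ih | ih
      · obtain ⟨g, hg⟩ := hall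
        exact absurd (mem_add.2 ⟨g, ih g, 0, h0, add_zero g⟩) hg
      · have hne : ((m + 1) • T).Nonempty := Finset.Nonempty.nsmul ⟨0, h0⟩
        have := two_mul_card_add_card_le h0 hneg hgen hne hall
        nlinarith

/-! ### The number of new elements gained by adding a shifted copy -/

/-- The number of elements of the translate `g + B` outside `B`. -/
def shiftGain (B : Finset G) (g : G) : ℕ := #((g +ᵥ B) \ B)

theorem shiftGain_zero (B : Finset G) : shiftGain B 0 = 0 := by simp [shiftGain]

theorem shiftGain_neg (B : Finset G) (g : G) : shiftGain B (-g) = shiftGain B g := by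
  have h1 : -g +ᵥ ((g +ᵥ B) \ B) = B \ (-g +ᵥ B) := by
    rw [vadd_finset_sdiff, neg_vadd_vadd]
  have h2 : #(B \ (-g +ᵥ B)) = #((-g +ᵥ B) \ B) := card_sdiff_comm (by rw [card_vadd_finset])
  rw [shiftGain, shiftGain, ← h2, ← h1, card_vadd_finset]

theorem shiftGain_add_le (B : Finset G) (g h : G) :
    shiftGain B (g + h) ≤ shiftGain B g + shiftGain B h := by
  have hsub : ((g + h) +ᵥ B) \ B ⊆ ((g +ᵥ B) \ B) ∪ (g +ᵥ ((h +ᵥ B) \ B)) := by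
    rw [add_vadd, vadd_finset_sdiff]
    intro x hx
    simp only [mem_union, mem_sdiff] at hx ⊢
    tauto
  calc shiftGain B (g + h) ≤ _ := card_le_card hsub
    _ ≤ _ := card_union_le _ _
    _ = _ := by rw [card_vadd_finset]; rfl

theorem shiftGain_nsmul_le {B T : Finset G} {L : ℕ} (hT : ∀ x ∈ T, shiftGain B x ≤ L) (m : ℕ) :
    ∀ g ∈ m • T, shiftGain B g ≤ m * L := by
  induction m with
  | zero => intro g hg; simp at hg; simp [hg, shiftGain_zero]
  | succ m ih =>
    intro g hg
    rw [succ_nsmul] at hg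
    obtain ⟨x, hx, y, hy, rfl⟩ := mem_add.1 hg
    have := shiftGain_add_le B x y
    have := ih x hx
    have := hT y hy
    nlinarith

/-- Each pair of elements of `B` has only one difference, so the translates of `B` by the elements
of `K` meet `B` in at most `#B ^ 2` points altogether. -/
theorem card_mul_card_le_sum_shiftGain (B K : Finset G) :
    #K * #B ≤ ∑ g ∈ K, shiftGain B g + #B * #B := by
  have h1 : ∀ g, #B = shiftGain B g + #((g +ᵥ B) ∩ B) := fun g => by
    rw [shiftGain, card_sdiff_add_card_inter, card_vadd_finset]
  have h2 : ∑ g ∈ K, #((g +ᵥ B) ∩ B) ≤ #B * #B := by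
    rw [← card_sigma, ← card_product]
    refine card_le_card_of_injOn (fun x => (x.2 - x.1, x.2)) ?_ ?_
    · rintro ⟨g, y⟩ hy
      simp only [coe_sigma, Set.mem_sigma_iff, mem_coe, mem_inter, mem_vadd_finset] at hy
      obtain ⟨-, ⟨x, hx, rfl⟩, hy⟩ := hy
      simpa using ⟨hx, hy⟩
    · rintro ⟨g, y⟩ - ⟨g', y'⟩ - h
      simp only [Prod.mk.injEq] at h
      obtain ⟨h1, rfl⟩ := h
      simpa using h1
  calc #K * #B = ∑ g ∈ K, (shiftGain B g + #((g +ᵥ B) ∩ B)) := by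
        rw [← sum_congr rfl fun g _ => h1 g]; simp
    _ ≤ _ := by rw [sum_add_distrib]; omega

/-- The symmetric set `P ∪ -P ∪ {0}`. -/
def symmHull (P : Finset G) : Finset G := insert 0 (P ∪ -P)

theorem card_symmHull {P : Finset G} (h0 : 0 ∉ P) (hP : ∀ x ∈ P, -x ∉ P) :
    #(symmHull P) = 2 * #P + 1 := by
  have hd : Disjoint P (-P) := by
    rw [disjoint_left]
    intro x hx hx'
    exact hP x hx (mem_neg'.1 hx')
  rw [symmHull, card_insert_of_notMem (by simpa using h0), card_union_of_disjoint hd, card_neg]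
  omega

theorem neg_mem_symmHull {P : Finset G} : ∀ x ∈ symmHull P, -x ∈ symmHull P := by
  intro x hx
  simp only [symmHull, mem_insert, mem_union, mem_neg', neg_neg, neg_eq_zero] at hx ⊢
  tauto

theorem closure_symmHull {P : Finset G} (hP : AddSubgroup.closure (P : Set G) = ⊤) :
    AddSubgroup.closure (symmHull P : Set G) = ⊤ := by
  rw [eq_top_iff, ← hP]
  apply AddSubgroup.closure_mono
  intro x hx
  simp only [symmHull, coe_insert, coe_union, Set.mem_insert_iff, Set.mem_union]
  exact Or.inr (Or.inl hx)

theorem shiftGain_symmHull_le {B P : Finset G} {L : ℕ} (hL : ∀ x ∈ P, shiftGain B x ≤ L) :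
    ∀ x ∈ symmHull P, shiftGain B x ≤ L := by
  intro x hx
  simp only [symmHull, mem_insert, mem_union, mem_neg'] at hx
  rcases hx with rfl | hx | hx
  · simp [shiftGain_zero]
  · exact hL x hx
  · rw [← shiftGain_neg]; exact hL _ hx

/-- Averaging the gain over `P ∪ -P`. The result is good as long as `B` is not larger than `P`. -/
theorem card_mul_le_of_shiftGain_le {B P : Finset G} {L : ℕ} (h0 : 0 ∉ P)
    (hP : ∀ x ∈ P, -x ∉ P) (hL : ∀ x ∈ P, shiftGain B x ≤ L) :
    (2 * #P + 1) * #B ≤ 2 * #P * L + #B * #B := by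
  have h1 := card_mul_card_le_sum_shiftGain B (symmHull P)
  have hc := card_symmHull h0 hP
  have h2 : ∑ g ∈ symmHull P, shiftGain B g ≤ 2 * #P * L := by
    have h0' : 0 ∉ P ∪ -P := by simpa using h0
    rw [symmHull, sum_insert h0', shiftGain_zero, zero_add]
    have hc' : #(P ∪ -P) = 2 * #P := by
      rw [symmHull, card_insert_of_notMem h0'] at hc
      omega
    rw [← hc', ← smul_eq_mul]
    refine sum_le_card_nsmul _ _ _ fun x hx => ?_
    exact shiftGain_symmHull_le hL x (mem_insert_of_mem hx)
  rw [hc] at h1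
  omega

theorem mul_sum_max_one_le {c q : ℕ} (hq : c ≤ q) :
    c * ∑ j ∈ range q, max 1 (2 * j / c) ≤ q * q := by
  induction q, hq using Nat.le_induction with
  | base =>
    gcongr
    calc ∑ j ∈ range c, max 1 (2 * j / c) ≤ ∑ j ∈ range c, 1 := by
          refine sum_le_sum fun j hj => ?_
          have hj := mem_range.1 hj
          have : 2 * j / c < 2 := Nat.div_lt_of_lt_mul (by omega)
          omega
      _ = c := by simp
  | succ q hq ih =>
    rw [sum_range_succ, mul_add]
    have h1 : c * max 1 (2 * q / c) ≤ 2 * q := by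
      rcases le_total 1 (2 * q / c) with h | h
      · rw [max_eq_right h]; exact Nat.mul_div_le _ _
      · rw [max_eq_left h]; omega
    nlinarith

/-- Elements of the multiples `m • T` of the symmetric hull `T` have gain at most `m * L`, and
these multiples grow at least linearly; so `q` elements can be chosen of small total gain. -/
theorem exists_card_eq_sum_shiftGain_le {B P : Finset G} {L : ℕ} (h0 : 0 ∉ P)
    (hP : ∀ x ∈ P, -x ∉ P) (hgen : AddSubgroup.closure (P : Set G) = ⊤)
    (hL : ∀ x ∈ P, shiftGain B x ≤ L) (q : ℕ) (hq : ∀ X : Finset G, #X < q → ∃ g, g ∉ X) :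
    ∃ K : Finset G, #K = q ∧
      ∑ g ∈ K, shiftGain B g ≤ L * ∑ j ∈ range q, max 1 (2 * j / (2 * #P + 1)) := by
  induction q with
  | zero => exact ⟨∅, by simp⟩
  | succ q ih =>
    obtain ⟨K, hK, hsum⟩ := ih fun X hX => hq X (by omega)
    obtain ⟨g, hgK, hg⟩ : ∃ g ∉ K, shiftGain B g ≤ L * max 1 (2 * q / (2 * #P + 1)) := by
      obtain ⟨m, hm⟩ : ∃ m, m + 1 = max 1 (2 * q / (2 * #P + 1)) :=
        ⟨max 1 (2 * q / (2 * #P + 1)) - 1, by omega⟩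
      rw [← hm]
      have hmem : ∀ g ∈ (m + 1) • symmHull P, shiftGain B g ≤ L * (m + 1) := fun g hg =>
        (shiftGain_nsmul_le (shiftGain_symmHull_le hL) (m + 1) g hg).trans (mul_comm _ _).le
      rcases card_nsmul_ge (T := symmHull P) (mem_insert_self 0 _) neg_mem_symmHull
        (closure_symmHull hgen) m with hall | hcard
      · obtain ⟨g, hg⟩ := hq K (by omega)
        exact ⟨g, hg, hmem g (hall g)⟩
      · rw [card_symmHull h0 hP] at hcard
        have h1 : 2 * q < (2 * #P + 1) * (m + 2) := by
          have := Nat.lt_mul_div_succ (2 * q) (show 0 < 2 * #P + 1 by omega)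
          refine this.trans_le (Nat.mul_le_mul_left _ ?_)
          omega
        obtain ⟨g, hg, hgK⟩ := exists_mem_notMem_of_card_lt_card
          (s := K) (t := (m + 1) • symmHull P) (by nlinarith)
        exact ⟨g, hgK, hmem g hg⟩
    refine ⟨insert g K, by rw [card_insert_of_notMem hgK, hK], ?_⟩
    rw [sum_insert hgK, sum_range_succ, mul_add]
    omega

/-- Olson's bound for the gain of a set `B` which is larger than `P` but fills at most half of the
group. -/
theorem two_mul_card_add_one_le_of_shiftGain_le {B P : Finset G} {L : ℕ} (h0 : 0 ∉ P)
    (hP : ∀ x ∈ P, -x ∉ P) (hgen : AddSubgroup.closure (P : Set G) = ⊤)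
    (hL : ∀ x ∈ P, shiftGain B x ≤ L) (hB : ∀ X : Finset G, #X < 2 * #B → ∃ g, g ∉ X)
    (hPB : #P < #B) : 2 * #P + 1 ≤ 4 * L := by
  obtain ⟨K, hK, hsum⟩ := exists_card_eq_sum_shiftGain_le h0 hP hgen hL _ hB
  have h1 := card_mul_card_le_sum_shiftGain B K
  have h2 := mul_sum_max_one_le (c := 2 * #P + 1) (q := 2 * #B) (by omega)
  rw [hK] at h1
  set c := ∑ j ∈ range (2 * #B), max 1 (2 * j / (2 * #P + 1))
  have h3 : #B * #B ≤ L * c := by nlinarith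
  have h4 : (2 * #P + 1) * (#B * #B) ≤ 4 * L * (#B * #B) := by
    calc (2 * #P + 1) * (#B * #B) ≤ (2 * #P + 1) * (L * c) := by gcongr
      _ = L * ((2 * #P + 1) * c) := by ring
      _ ≤ L * (2 * #B * (2 * #B)) := by gcongr
      _ = _ := by ring
  exact Nat.le_of_mul_le_mul_right h4 (by have : 0 < #B := by omega
                                          positivity)

/-! ### The greedy construction -/

/-- The guaranteed gain when a set of at least `b` sums is enlarged by a suitable one of `p`
remaining elements: `b (2p + 1 - b) / (2p)` or `(p + 1) / 2`, rounded up. -/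
def gain (b p : ℕ) : ℕ :=
  if b ≤ p then (b * (2 * p + 1 - b) + (2 * p - 1)) / (2 * p) else (p + 2) / 2

/-- The guaranteed number of sums after `i` greedy choices from a set of `k` elements. -/
def greedy (k : ℕ) : ℕ → ℕ
  | 0 => 1
  | i + 1 => greedy k i + gain (greedy k i) (k - i)

theorem mul_gain_le {b p : ℕ} (hbp : b ≤ p) :
    2 * p * gain b p ≤ b * (2 * p + 1 - b) + (2 * p - 1) := by
  rw [gain, if_pos hbp]
  exact Nat.mul_div_le _ _

theorem gain_le_self {b p : ℕ} (hb : 0 < b) : gain b p ≤ b := by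
  rw [gain]
  split_ifs with h
  · rw [← Nat.lt_succ_iff, Nat.div_lt_iff_lt_mul (by omega)]
    obtain ⟨c, rfl⟩ : ∃ c, b = c + 1 := ⟨b - 1, by omega⟩
    have h1 : 2 * p + 1 - (c + 1) = 2 * p - c := by omega
    rw [h1]
    have : (c + 1) * (2 * p - c) ≤ (c + 1) * (2 * p) := Nat.mul_le_mul_left _ (by omega)
    have h2 : (c + 1).succ * (2 * p) = (c + 1) * (2 * p) + 2 * p := by
      rw [Nat.succ_mul]
    omega
  · omega

theorem greedy_pos (k i : ℕ) : 0 < greedy k i := by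
  induction i with
  | zero => simp [greedy]
  | succ i ih => rw [greedy]; omega

/-- Some element of `P` has at least the guaranteed gain. The set `B` may be larger than the
number `β` for which the gain is computed, since `b + gain b p` is essentially increasing in `b`. -/
theorem exists_gain_le {B P : Finset G} (hPne : P.Nonempty) (h0 : 0 ∉ P)
    (hP : ∀ x ∈ P, -x ∉ P) (hgen : AddSubgroup.closure (P : Set G) = ⊤)
    (hB : ∀ X : Finset G, #X < 2 * #B → ∃ g, g ∉ X) {β : ℕ} (hβ : 0 < β) (hβB : β ≤ #B) :
    ∃ x ∈ P, β + gain β #P ≤ #B + shiftGain B x := by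
  by_contra! hcon
  obtain ⟨L, hL⟩ : ∃ L, L + #B + 1 = β + gain β #P := by
    obtain ⟨x, hx⟩ := hPne
    exact ⟨β + gain β #P - #B - 1, by have := hcon x hx; omega⟩
  have hle : ∀ x ∈ P, shiftGain B x ≤ L := fun x hx => by have := hcon x hx; omega
  have hp : 0 < #P := hPne.card_pos
  have h1 := card_mul_le_of_shiftGain_le h0 hP hle
  have h2 := two_mul_card_add_one_le_of_shiftGain_le h0 hP hgen hle hB
  generalize #P = p at *
  generalize #B = b at *
  by_cases hβp : β ≤ p
  · have hg := mul_gain_le hβp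
    obtain ⟨c, rfl⟩ : ∃ c, p = β + c := ⟨p - β, by omega⟩
    obtain ⟨d, rfl⟩ : ∃ d, b = β + d := ⟨b - β, by omega⟩
    have e1 : 2 * (β + c) + 1 - β = β + 2 * c + 1 := by omega
    have e2 : 2 * (β + c) * (L + (β + d) + 1) =
        2 * (β + c) * β + 2 * (β + c) * gain β (β + c) := by rw [hL]; ring
    rw [e1] at hg
    have hg' : 2 * (β + c) * gain β (β + c) + 1 ≤ β * (β + 2 * c + 1) + 2 * (β + c) := by omega
    by_cases hbp : β + d ≤ β + c
    · have hdc : d ≤ c := by omega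
      nlinarith [Nat.mul_le_mul_left d hdc]
    · have hL4 := h2 (by omega)
      have : c + 1 ≤ d := by omega
      nlinarith [Nat.mul_le_mul_left (β + c) hL4, Nat.mul_le_mul_left (β + c) this]
  · have hg : gain β p ≤ (p + 2) / 2 := by rw [gain, if_neg hβp]
    have := h2 (by omega)
    omega

theorem sumFinset_insert {A : Finset G} {x : G} (hx : x ∉ A) :
    sumFinset (insert x A).val = sumFinset A.val ∪ (x +ᵥ sumFinset A.val) := by
  rw [insert_val_of_notMem hx, ← Multiset.singleton_add, sumFinset_add, sumFinset_singleton,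
    insert_eq, union_add, singleton_add, singleton_add, zero_vadd]

theorem sumFinset_map {H : Type*} [AddCommGroup H] [DecidableEq H] (f : H →+ G)
    (S : Multiset H) : sumFinset (S.map f) = (sumFinset S).image f := by
  induction S using Multiset.induction with
  | empty => simp [sumFinset]
  | cons a S ih =>
    rw [Multiset.map_cons, ← Multiset.singleton_add, ← Multiset.singleton_add, sumFinset_add,
      sumFinset_add, image_add, ih, sumFinset_singleton, sumFinset_singleton]
    simp [image_insert]

theorem card_sumFinset_insert {A : Finset G} {x : G} (hx : x ∉ A) :
    #(sumFinset (insert x A).val) = #(sumFinset A.val) + shiftGain (sumFinset A.val) x := by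
  rw [sumFinset_insert hx, shiftGain, add_comm, card_sdiff_add_card, union_comm]

theorem val_add_val_sdiff {α : Type*} [DecidableEq α] {A B : Finset α} (h : B ⊆ A) :
    B.val + (A \ B).val = A.val := by
  rw [sdiff_val, add_tsub_cancel_of_le (Finset.val_le_iff.2 h)]

/-- An element of order two is its own negative, but occurs only once in a set. -/
theorem ZeroSumFree.neg_notMem {A : Finset G} (hA : ZeroSumFree A.val) {x : G} (hx : x ∈ A)
    (hne : -x ≠ x) : -x ∉ A := by
  intro hx'
  refine hA ({x, -x} : Finset G).val (Finset.val_le_iff.2 ?_)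
    (fun h => insert_ne_empty x {-x} (Finset.val_eq_zero.1 h)) ?_
  · intro y hy
    simp only [mem_insert, mem_singleton] at hy
    rcases hy with rfl | rfl <;> assumption
  · rw [insert_val_of_notMem (by simpa using hne.symm)]
    simp

/-- An involution doubles the set of sums of a set of other involutions. -/
theorem card_sumFinset_insert_involution {A : Finset G} {x : G} (hx : x ∉ A)
    (hA : ZeroSumFree (insert x A).val) (hinv : ∀ y ∈ insert x A, -y = y) :
    #(sumFinset (insert x A).val) = 2 * #(sumFinset A.val) := by
  have hsub : ∀ y ∈ sumFinset A.val, -y = y := by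
    intro y hy
    obtain ⟨T, hT, rfl⟩ := mem_sumFinset.1 hy
    rw [← Multiset.sum_map_neg']
    congr 1
    conv_rhs => rw [← Multiset.map_id T]
    refine Multiset.map_congr rfl fun z hz => hinv z (mem_insert_of_mem ?_)
    exact Multiset.mem_of_le hT hz
  have hcl : ∀ y ∈ sumFinset A.val, ∀ z ∈ sumFinset A.val, y + z ∈ sumFinset A.val := by
    intro y hy z hz
    obtain ⟨T, hT, rfl⟩ := mem_sumFinset.1 hy
    obtain ⟨U, hU, rfl⟩ := mem_sumFinset.1 hz
    refine mem_sumFinset.2 ⟨(T - U) + (U - T), ?_, ?_⟩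
    · rw [Multiset.le_iff_count] at hT hU ⊢
      intro a
      have := hT a
      have := hU a
      simp only [Multiset.count_add, Multiset.count_sub]
      omega
    · have e1 : T = (T - U) + (T ∩ U) := by
        ext a; simp only [Multiset.count_add, Multiset.count_inter, Multiset.count_sub]; omega
      have e2 : U = (U - T) + (T ∩ U) := by
        ext a; simp only [Multiset.count_add, Multiset.count_inter, Multiset.count_sub]; omega
      have e3 : (T ∩ U).sum + (T ∩ U).sum = 0 := by
        have := hsub _ (mem_sumFinset.2 ⟨T ∩ U, Multiset.inter_le_left.trans hT, rfl⟩)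
        nth_rewrite 1 [← this]
        simp
      have s1 := congrArg Multiset.sum e1
      have s2 := congrArg Multiset.sum e2
      rw [Multiset.sum_add] at s1 s2
      rw [s1, s2, Multiset.sum_add, add_add_add_comm, e3, add_zero]
  rw [sumFinset_insert hx, card_union_of_disjoint, card_vadd_finset, two_mul]
  rw [disjoint_left]
  intro y hy hy'
  obtain ⟨z, hz, rfl⟩ := mem_vadd_finset.1 hy'
  have h1 : x ∈ sumFinset A.val := by
    have := hcl _ hy _ hz
    have h2 : z + z = 0 := by nth_rewrite 1 [← hsub z hz]; simp
    rwa [vadd_eq_add, add_assoc, h2, add_zero] at this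
  have hA' := hA
  rw [insert_val_of_notMem hx, ← Multiset.singleton_add] at hA'
  have hx0 := hA'.eq_zero_of_add (x := x) (y := x) (by simp [sumFinset_singleton]) h1
    (by nth_rewrite 1 [← hinv x (mem_insert_self _ _)]; simp)
  exact hA.zero_notMem (by simp [hx0])

/-- If `P ⊆ A` generates a proper subgroup and `a ∈ A` lies outside it, then the sums over `P` and
their translates by `a` lie in different cosets of the subgroup. -/
theorem two_mul_card_sumFinset_le {A P : Finset G} (hPA : P ⊆ A)
    (hA : AddSubgroup.closure (A : Set G) = ⊤) (hP : AddSubgroup.closure (P : Set G) ≠ ⊤) :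
    2 * #(sumFinset P.val) ≤ #(sumFinset A.val) := by
  obtain ⟨a, haA, ha⟩ : ∃ a ∈ A, a ∉ AddSubgroup.closure (P : Set G) := by
    by_contra! hall
    exact hP (eq_top_iff.2 (hA ▸ (AddSubgroup.closure_le _).2 hall))
  have haP : a ∉ P := fun h => ha (AddSubgroup.subset_closure h)
  have hmem : ∀ y ∈ sumFinset P.val, y ∈ AddSubgroup.closure (P : Set G) := by
    intro y hy
    obtain ⟨T, hT, rfl⟩ := mem_sumFinset.1 hy
    exact AddSubgroup.multiset_sum_mem _ _ fun z hz =>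
      AddSubgroup.subset_closure (Multiset.mem_of_le hT hz)
  have hsub : sumFinset (insert a P).val ⊆ sumFinset A.val :=
    sumFinset_mono (Finset.val_le_iff.2 (insert_subset haA hPA))
  refine le_trans ?_ (card_le_card hsub)
  rw [sumFinset_insert haP, card_union_of_disjoint, card_vadd_finset, two_mul]
  rw [disjoint_left]
  intro y hy hy'
  obtain ⟨z, hz, rfl⟩ := mem_vadd_finset.1 hy'
  refine ha ?_
  have := AddSubgroup.sub_mem _ (hmem _ hy) (hmem _ hz)
  simpa using this

/-- In a finite group, the sums of `S` and the negatives of the sums of `T` have to fit in side by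
side, as they have only zero in common. Here `X` stands for the whole group. -/
theorem card_sumFinset_le_of_covered {S T : Multiset G} (h : ZeroSumFree (S + T)) {X : Finset G}
    (hX : ∀ g, g ∈ X) : #(sumFinset S) + #(sumFinset T) ≤ #X + 1 := by
  have hinter : sumFinset S ∩ -sumFinset T ⊆ {0} := by
    intro x hx
    obtain ⟨h1, h2⟩ := mem_inter.1 hx
    have := h.eq_zero_of_add h1 (mem_neg'.1 h2) (by simp)
    simpa using this
  have h1 := card_union_add_card_inter (sumFinset S) (-sumFinset T)
  have h2 : #(sumFinset S ∪ -sumFinset T) ≤ #X := card_le_card fun x _ => hX x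
  have h3 := card_le_card hinter
  rw [card_neg] at h1
  simp only [card_singleton] at h3
  omega

/-- Induction step for lower bounds for the number of sums: choose `t` elements greedily. If the
gain is not guaranteed at some step, because the remaining elements generate a proper subgroup or
because the sums already fill more than half of the group, there are already about twice as many
sums as for the remaining elements, which is enough by `hw`. -/
theorem lt_card_sumFinset_of_greedy {A : Finset G} (hA : ZeroSumFree A.val)
    (hgen : AddSubgroup.closure (A : Set G) = ⊤) {h : ℕ → ℕ} {w t : ℕ} (ht : 0 < t)
    (htA : t ≤ #A)
    (ih : ∀ P ⊆ A, #P < #A → h #P < #(sumFinset P.val))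
    (hw : ∀ i, 0 < i → i < t → w ≤ 2 * h (#A - i))
    (hend : w < greedy #A t + h (#A - t)) : w < #(sumFinset A.val) := by
  by_contra! hlt
  -- The elements of order two are chosen first: each of them doubles the number of sums, and the
  -- bounds for the gain need the remaining set to be disjoint from its negative.
  have hchain : ∀ i ≤ t, ∃ B ⊆ A, #B = i ∧ greedy #A i ≤ #(sumFinset B.val) ∧
      ((∀ y ∈ B, -y = y) ∨ ∀ y ∈ A \ B, -y ≠ y) := by
    intro i
    induction i with
    | zero => exact fun _ => ⟨∅, by simp, rfl, card_sumFinset_pos _, by simp⟩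
    | succ i ihi =>
      intro hi
      obtain ⟨B, hBA, hBi, hB, hinv⟩ := ihi (by omega)
      have hPcard : #(A \ B) = #A - i := by rw [card_sdiff_of_subset hBA, hBi]
      have hzs : ZeroSumFree (B.val + (A \ B).val) := by rwa [val_add_val_sdiff hBA]
      by_cases hex : ∃ x ∈ A \ B, -x = x
      · obtain ⟨x, hx, hxx⟩ := hex
        obtain ⟨hxA, hxB⟩ := mem_sdiff.1 hx
        have hBinv : ∀ y ∈ B, -y = y := hinv.resolve_right fun h => h x hx hxx
        have hinv' : ∀ y ∈ insert x B, -y = y := by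
          intro y hy
          rcases mem_insert.1 hy with rfl | hy
          exacts [hxx, hBinv y hy]
        have hsub : insert x B ⊆ A := insert_subset hxA hBA
        refine ⟨insert x B, hsub, by rw [card_insert_of_notMem hxB, hBi], ?_, Or.inl hinv'⟩
        rw [card_sumFinset_insert_involution hxB (hA.mono (Finset.val_le_iff.2 hsub)) hinv',
          greedy]
        have := gain_le_self (p := #A - i) (greedy_pos #A i)
        omega
      · push Not at hex
        have hPpos : 0 < #(A \ B) := by omega
        have hgenP : AddSubgroup.closure ((A \ B : Finset G) : Set G) = ⊤ := by
          by_contra hne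
          rcases Nat.eq_zero_or_pos i with rfl | hi0
          · rw [card_eq_zero] at hBi
            subst hBi
            rw [sdiff_empty] at hne
            exact hne hgen
          · have h1 := two_mul_card_sumFinset_le sdiff_subset hgen hne
            have h2 := ih (A \ B) sdiff_subset (by omega)
            have h3 := hw i hi0 (by omega)
            rw [hPcard] at h2
            omega
        have hbig : ∀ X : Finset G, #X < 2 * #(sumFinset B.val) → ∃ g, g ∉ X := by
          intro X hX
          by_contra! hall
          have h1 := card_sumFinset_le_of_covered hzs hall
          have h4 := card_sumFinset_add hzs
          rw [val_add_val_sdiff hBA] at h4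
          rcases Nat.eq_zero_or_pos i with rfl | hi0
          · have h2 := card_lt_card_sumFinset
              (hA.mono (Finset.val_le_iff.2 (sdiff_subset (t := B))))
            rw [card_eq_zero] at hBi
            subst hBi
            have h3 : #(sumFinset (∅ : Finset G).val) = 1 := by
              simp [sumFinset]
            rw [h3] at hX h1
            have : (A \ ∅).val.card = #(A \ ∅) := rfl
            omega
          · have h2 := ih (A \ B) sdiff_subset (by omega)
            have h3 := hw i hi0 (by omega)
            rw [hPcard] at h2
            omega
        have h0 : 0 ∉ A \ B := fun h0 => hA.zero_notMem (mem_sdiff.1 h0).1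
        obtain ⟨x, hx, hgain⟩ := exists_gain_le (card_pos.1 hPpos) h0
          (fun x hx hx' => hA.neg_notMem (mem_sdiff.1 hx).1 (hex x hx) (mem_sdiff.1 hx').1)
          hgenP hbig (greedy_pos #A i) hB
        obtain ⟨hxA, hxB⟩ := mem_sdiff.1 hx
        refine ⟨insert x B, insert_subset hxA hBA, by rw [card_insert_of_notMem hxB, hBi], ?_,
          Or.inr fun y hy => hex y ?_⟩
        · rwa [card_sumFinset_insert hxB, greedy, ← hPcard]
        · simp only [mem_sdiff, mem_insert, not_or] at hy ⊢
          exact ⟨hy.1, hy.2.2⟩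
  obtain ⟨B, hBA, hBt, hB, -⟩ := hchain t le_rfl
  have hPcard : #(A \ B) = #A - t := by rw [card_sdiff_of_subset hBA, hBt]
  have hzs : ZeroSumFree (B.val + (A \ B).val) := by rwa [val_add_val_sdiff hBA]
  have h1 := card_sumFinset_add hzs
  have h2 := ih (A \ B) sdiff_subset (by omega)
  rw [val_add_val_sdiff hBA] at h1
  rw [hPcard] at h2
  omega

/-- The previous bound without the hypothesis that `A` generates `G`. -/
theorem lt_card_sumFinset_of_greedy' {A : Finset G} (hA : ZeroSumFree A.val)
    {h : ℕ → ℕ} {w t : ℕ} (ht : 0 < t) (htA : t ≤ #A)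
    (ih : ∀ P ⊆ A, #P < #A → h #P < #(sumFinset P.val))
    (hw : ∀ i, 0 < i → i < t → w ≤ 2 * h (#A - i))
    (hend : w < greedy #A t + h (#A - t)) : w < #(sumFinset A.val) := by
  set H := AddSubgroup.closure (A : Set G) with hH
  let e : H ↪ G := ⟨H.subtype, H.subtype_injective⟩
  obtain ⟨A', hA', hpre⟩ : ∃ A' : Finset H, A'.map e = A ∧ (A' : Set H) = (↑) ⁻¹' (A : Set G) := by
    classical
    refine ⟨A.preimage e e.injective.injOn, ?_, coe_preimage (f := e) A e.injective.injOn⟩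
    rw [map_eq_image, image_preimage]
    refine filter_true_of_mem fun x hx => ⟨⟨x, AddSubgroup.subset_closure hx⟩, rfl⟩
  have hcard : #A' = #A := by rw [← hA', card_map]
  have hmap' : ∀ P : Finset H, #(sumFinset (P.map e).val) = #(sumFinset P.val) := by
    intro P
    rw [← card_image_of_injective (sumFinset P.val) H.subtype_injective, ← sumFinset_map]
    rfl
  rw [← hA', hmap']
  refine lt_card_sumFinset_of_greedy ?_ ?_ ht (hcard ▸ htA) (h := h) ?_ (hcard ▸ hw)
    (hcard ▸ hend)
  · intro T hT hT0 hsum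
    refine hA (T.map H.subtype) ?_ (by simpa using hT0) ?_
    · rw [← hA']; exact Multiset.map_le_map hT
    · rw [← map_multiset_sum, hsum, map_zero]
  · rw [hpre]
    exact AddSubgroup.closure_closure_coe_preimage
  · intro P hP hPlt
    have := ih (P.map e) (by rw [← hA']; exact map_subset_map.2 hP) (by rw [card_map]; omega)
    rwa [hmap', card_map] at this

/-! ### A quadratic lower bound for the number of sums of a set -/

/-- A lower bound for the number of nonzero sums of a zero-sum-free set of `k` elements: the
quadratic `k ^ 2 / 6`, rounded up, replaced for `k ≤ 22` by slightly larger values that the greedy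
construction gives, without which the induction would fail for some `k ≤ 30`. -/
def setBound (k : ℕ) : ℕ :=
  if k ≤ 22 then
    [0, 1, 2, 4, 5, 7, 10, 11, 14, 18, 21, 23, 28, 32, 37, 42, 46, 50, 57, 64, 71, 77, 84].getD k 0
  else (k * k + 5) / 6

theorem setBound_of_lt {k : ℕ} (hk : 22 < k) : setBound k = (k * k + 5) / 6 := by
  rw [setBound, if_neg (by omega)]

theorem sq_le_setBound (k : ℕ) : k * k ≤ 6 * setBound k := by
  by_cases hk : k ≤ 22
  · have : ∀ k < 23, k * k ≤ 6 * setBound k := by decide +kernel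
    exact this k (by omega)
  · rw [setBound_of_lt (by omega)]
    omega

/-- For fewer than 252 elements, the numerical hypotheses of `lt_card_sumFinset_of_greedy` are
checked by evaluation, here and in the next two lemmas. -/
theorem exists_setBound_lt_greedy : ∀ k < 23, 2 ≤ k → ∃ t < k, 0 < t ∧
    (∀ i < t, 0 < i → setBound k ≤ 2 * setBound (k - i)) ∧
    setBound k < greedy k t + setBound (k - t) := by
  decide +kernel

theorem setBound_lt_greedy_of_lt_hundred : ∀ k < 100, 22 < k →
    (∀ i < k / 4 + 2, 0 < i → setBound k ≤ 2 * setBound (k - i)) ∧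
    setBound k < greedy k (k / 4 + 2) + setBound (k - (k / 4 + 2)) := by
  decide +kernel

theorem setBound_lt_greedy_of_lt : ∀ k < 252, 100 ≤ k →
    (∀ i < k / 4, 0 < i → setBound k ≤ 2 * setBound (k - i)) ∧
    setBound k < greedy k (k / 4) + setBound (k - k / 4) := by
  decide +kernel

theorem add_one_le_two_mul_gain {b p : ℕ} (hp : 0 < p) (hb : p ≤ b) : p + 1 ≤ 2 * gain b p := by
  rw [gain]
  split_ifs with h
  · obtain rfl : b = p := by omega
    have h1 : 2 * b + 1 - b = b + 1 := by omega
    rw [h1]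
    have := Nat.lt_mul_div_succ (b * (b + 1) + (2 * b - 1)) (show 0 < 2 * b by omega)
    set g := (b * (b + 1) + (2 * b - 1)) / (2 * b)
    have h2 : 2 * b * (g + 1) = b * (2 * g) + 2 * b := by ring
    have h3 : b * (b + 1) ≤ b * (2 * g) := by omega
    exact Nat.le_of_mul_le_mul_left h3 hp
  · omega

theorem self_le_two_mul_gain {b p : ℕ} (hb : 0 < b) (hbp : b ≤ p) : b ≤ 2 * gain b p := by
  rw [gain, if_pos hbp]
  have := Nat.lt_mul_div_succ (b * (2 * p + 1 - b) + (2 * p - 1)) (show 0 < 2 * p by omega)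
  set g := (b * (2 * p + 1 - b) + (2 * p - 1)) / (2 * p)
  have h1 : b * (p + 1) ≤ b * (2 * p + 1 - b) := Nat.mul_le_mul_left _ (by omega)
  have h2 : 2 * p * (g + 1) = p * (2 * g) + 2 * p := by ring
  have h3 : b * (p + 1) = p * b + b := by ring
  have h4 : p * b ≤ p * (2 * g) := by omega
  exact Nat.le_of_mul_le_mul_left h4 (by omega)

/-- As long as there are fewer sums than remaining elements, each step multiplies their number by
at least `3 / 2`. -/
theorem exponential_le_greedy (k i : ℕ) (hi : i < k) :
    3 ^ i ≤ 2 ^ i * greedy k i ∨ k - i ≤ greedy k i := by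
  induction i with
  | zero => left; simp [greedy]
  | succ i ih =>
    rw [greedy]
    by_cases hb : k - i ≤ greedy k i
    · right; omega
    · left
      have h1 := (ih (by omega)).resolve_right hb
      have h2 := self_le_two_mul_gain (greedy_pos k i) (not_le.1 hb).le
      rw [pow_succ, pow_succ]
      nlinarith [Nat.mul_le_mul_left (2 ^ i) h2]

/-- Once there are at least as many sums as remaining elements, each step gains at least half the
number of remaining elements. -/
theorem linear_le_greedy {k s t : ℕ} (ht : t < k) (hs : k - s ≤ greedy k s) (j : ℕ)
    (hj : s + j ≤ t) :
    2 * (k - s) + j * (k - t) ≤ 2 * greedy k (s + j) ∧ k - (s + j) ≤ greedy k (s + j) := by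
  induction j with
  | zero => simpa using hs
  | succ j ih =>
    obtain ⟨h1, h2⟩ := ih (by omega)
    have h3 := add_one_le_two_mul_gain (b := greedy k (s + j)) (p := k - (s + j)) (by omega) h2
    rw [← add_assoc, greedy]
    constructor
    · rw [add_mul, one_mul]; omega
    · omega

theorem mul_two_pow_le_three_pow {s : ℕ} (hs : 14 ≤ s) : 18 * (s + 1) * 2 ^ s ≤ 3 ^ s := by
  induction s, hs using Nat.le_induction with
  | base => norm_num
  | succ s hs ih =>
    rw [pow_succ, pow_succ]
    nlinarith [Nat.one_le_two_pow (n := s)]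

/-- For large `k`, the sums grow exponentially for the first `k / 18` steps and gain at least half
the number of remaining elements at each of the following steps, up to step `k / 4`. -/
theorem quadratic_le_greedy {k : ℕ} (hk : 252 ≤ k) :
    2 * k * (k / 4) + 6 ≤ 6 * greedy k (k / 4) + (k / 4) * (k / 4) := by
  obtain ⟨t, ht⟩ : ∃ t, t = k / 4 := ⟨_, rfl⟩
  obtain ⟨s, hs⟩ : ∃ s, s = k / 18 := ⟨_, rfl⟩
  have hks : k - s ≤ greedy k s := by
    refine (exponential_le_greedy k s (by omega)).elim (fun h => ?_) id
    have h1 := h.trans' (mul_two_pow_le_three_pow (s := s) (by omega))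
    rw [mul_comm] at h1
    have h2 := Nat.le_of_mul_le_mul_left h1 (by positivity)
    omega
  obtain ⟨h1, -⟩ := linear_le_greedy (t := t) (by omega) hks (t - s) (by omega)
  rw [show s + (t - s) = t by omega] at h1
  rw [← ht]
  obtain ⟨r, hr⟩ : ∃ r, k = 4 * t + r := ⟨k % 4, by omega⟩
  obtain ⟨d, hd⟩ : ∃ d, t = s + d := ⟨t - s, by omega⟩
  have hr3 : r ≤ 3 := by omega
  have e1 : k - s = 3 * s + 4 * d + r := by omega
  have e2 : t - s = d := by omega
  have e3 : k - t = 3 * (s + d) + r := by omega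
  have hsd : 7 * s ≤ 2 * d + 3 := by omega
  have hds : 60 ≤ s + d := by omega
  rw [e1, e2, e3] at h1
  have m1 := Nat.mul_le_mul_left d hsd
  have m2 := Nat.mul_le_mul_left s hsd
  have m3 := Nat.mul_le_mul_left s hr3
  generalize greedy k t = g at *
  rw [hr, hd]
  ring_nf at h1 m1 m2 m3 ⊢
  omega

/-- The number of nonzero sums of a zero-sum-free set of `k` elements is at least
`setBound k`. -/
theorem setBound_lt_card_sumFinset {A : Finset G} (hA : ZeroSumFree A.val) :
    setBound #A < #(sumFinset A.val) := by
  induction hk : #A using Nat.strong_induction_on generalizing A with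
  | _ k ih =>
    have ih' : ∀ P ⊆ A, #P < #A → setBound #P < #(sumFinset P.val) := fun P hP hPA =>
      ih #P (hk ▸ hPA) (hA.mono (Finset.val_le_iff.2 hP)) rfl
    have hstep : ∀ t, 0 < t → t ≤ k → (∀ i < t, 0 < i → setBound k ≤ 2 * setBound (k - i)) →
        setBound k < greedy k t + setBound (k - t) → setBound k < #(sumFinset A.val) := by
      subst hk
      exact fun t ht htA hw hend =>
        lt_card_sumFinset_of_greedy' hA ht htA ih' (fun i hi hit => hw i hit hi) hend
    by_cases h2 : k < 2
    · have := card_lt_card_sumFinset hA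
      have hc : A.val.card = k := hk
      have : setBound k = k := by interval_cases k <;> rfl
      omega
    by_cases h23 : k < 23
    · obtain ⟨t, htk, ht0, hw, hend⟩ := exists_setBound_lt_greedy k h23 (by omega)
      exact hstep t ht0 htk.le hw hend
    by_cases h100 : k < 100
    · obtain ⟨hw, hend⟩ := setBound_lt_greedy_of_lt_hundred k h100 (by omega)
      exact hstep _ (by omega) (by omega) hw hend
    by_cases h252 : k < 252
    · obtain ⟨hw, hend⟩ := setBound_lt_greedy_of_lt k h252 (by omega)
      exact hstep _ (by omega) (by omega) hw hend
    have hk' := setBound_of_lt (k := k) (by omega)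
    refine hstep (k / 4) (by omega) (by omega) (fun i hi hi0 => ?_) ?_
    · have h1 := sq_le_setBound (k - i)
      have h3 : (3 * k) * (3 * k) ≤ (4 * (k - i)) * (4 * (k - i)) :=
        Nat.mul_self_le_mul_self (by omega)
      have h4 : k * k ≤ 2 * ((k - i) * (k - i)) := by nlinarith
      omega
    · have h1 := sq_le_setBound (k - k / 4)
      have h3 := quadratic_le_greedy (k := k) (by omega)
      obtain ⟨t, ht⟩ : ∃ t, t = k / 4 := ⟨_, rfl⟩
      rw [← ht] at h1 h3 ⊢
      obtain ⟨m, rfl⟩ : ∃ m, k = t + m := ⟨k - t, by omega⟩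
      rw [Nat.add_sub_cancel_left] at h1 ⊢
      have h5 : (t + m) * (t + m) + 6 ≤ 6 * greedy (t + m) t + m * m := by nlinarith
      omega

/-! ### Sequences of bounded multiplicity -/

/-- Splitting a sequence whose multiplicities are at most `m` into `m` sets. -/
theorem sq_card_le {S : Multiset G} (hS : ZeroSumFree S) {m : ℕ} (hm : ∀ a, S.count a ≤ m) :
    S.card * S.card + 6 * m ≤ 6 * m * #(sumFinset S) := by
  induction m generalizing S with
  | zero =>
    have : S = 0 := Multiset.eq_zero_of_forall_notMem fun a ha => by
      have := hm a
      have := Multiset.count_pos.2 ha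
      omega
    simp [this]
  | succ m ih =>
    have hle : S.dedup ≤ S := S.dedup_le
    have hsplit : S.toFinset.val + (S - S.dedup) = S := add_tsub_cancel_of_le hle
    have h1 := setBound_lt_card_sumFinset (A := S.toFinset) (hS.mono hle)
    have h2 := sq_le_setBound #S.toFinset
    have h3 := ih (S := S - S.dedup) (hS.mono tsub_le_self) (fun a => by
      have := hm a
      rw [Multiset.count_sub, Multiset.count_dedup]
      split_ifs with ha
      · omega
      · rw [Multiset.count_eq_zero_of_notMem ha]; omega)
    have h4 := card_sumFinset_add (hsplit.symm ▸ hS)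
    have h5 : #S.toFinset + (S - S.dedup).card = S.card := by
      conv_rhs => rw [← hsplit, Multiset.card_add]
      rfl
    rw [hsplit] at h4
    generalize #S.toFinset = d at *
    generalize (S - S.dedup).card = e at *
    obtain ⟨x, hx⟩ : ∃ x, #(sumFinset S.toFinset.val) = x + 1 :=
      ⟨_, (Nat.sub_add_cancel (card_sumFinset_pos _)).symm⟩
    obtain ⟨y, hy⟩ : ∃ y, #(sumFinset (S - S.dedup)) = y + 1 :=
      ⟨_, (Nat.sub_add_cancel (card_sumFinset_pos _)).symm⟩
    rw [hx] at h1 h4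
    rw [hy] at h3 h4
    have hd : d * d ≤ 6 * x := by omega
    have he : e * e ≤ 6 * m * y := by nlinarith
    -- Cauchy-Schwarz: `(d + e) ^ 2 ≤ (m + 1) (d ^ 2 + e ^ 2 / m)`.
    have hde : (d + e) * (d + e) ≤ 6 * (m + 1) * (x + y) := by
      rcases Nat.eq_zero_or_pos m with rfl | hm0
      · have : e = 0 := by nlinarith
        subst this
        nlinarith
      · have hcs : 2 * (m * (d * e)) ≤ m * m * (d * d) + e * e := by
          zify
          nlinarith [sq_nonneg ((m : ℤ) * d - e)]
        have h6 : m * (2 * (d * e)) ≤ m * (6 * m * x + 6 * y) := by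
          nlinarith [Nat.mul_le_mul_left (m * m) hd]
        have h7 := Nat.le_of_mul_le_mul_left h6 hm0
        nlinarith
    rw [← h5]
    nlinarith

/-! ### The two largest multiplicities -/

theorem exists_count_eq_kthMult {α : Type*} [DecidableEq α] {S : Multiset α} (hS : S ≠ 0) :
    kthMult 2 S ≤ kthMult 1 S ∧ ∃ a ∈ S, S.count a = kthMult 1 S ∧
      (∀ c, c ≠ a → S.count c ≤ kthMult 2 S) ∧
      (2 ≤ S.toFinset.card ∨ 0 < kthMult 2 S → ∃ b ∈ S, b ≠ a ∧ S.count b = kthMult 2 S) := by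
  have hl : (((S.dedup.map fun a => S.count a).sort (· ≥ ·) : List ℕ) : Multiset ℕ) =
      S.dedup.map fun a => S.count a := Multiset.sort_eq _ _
  have hsort := Multiset.pairwise_sort (S.dedup.map fun a => S.count a) (· ≥ ·)
  have hcard : S.dedup.card = S.toFinset.card := rfl
  unfold kthMult
  generalize (S.dedup.map fun a => S.count a).sort (· ≥ ·) = l at hl hsort
  cases l with
  | nil =>
    have : S.dedup = 0 := by simpa using hl.symm
    exact absurd (Multiset.dedup_eq_zero.1 this) hS
  | cons x l =>
    have hx : x ∈ S.dedup.map fun a => S.count a := hl ▸ by simp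
    obtain ⟨a, ha, rfl⟩ := Multiset.mem_map.1 hx
    obtain ⟨D, hD⟩ := Multiset.exists_cons_of_mem ha
    rw [hD, Multiset.map_cons, ← Multiset.cons_coe, Multiset.cons_inj_right] at hl
    have hnd := hD ▸ S.nodup_dedup
    rw [Multiset.nodup_cons] at hnd
    rw [hD, Multiset.card_cons] at hcard
    have hDS : ∀ c ∈ D, c ∈ S := fun c hc =>
      Multiset.mem_dedup.1 (hD ▸ Multiset.mem_cons_of_mem hc)
    have hmemD : ∀ c ∈ S, c ≠ a → c ∈ D := fun c hc hca =>
      (Multiset.mem_cons.1 (hD ▸ Multiset.mem_dedup.2 hc)).resolve_left hca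
    cases l with
    | nil =>
      have hD0 : D = 0 := by simpa using hl.symm
      refine ⟨by simp, a, Multiset.mem_dedup.1 ha, by simp, fun c hca => ?_, fun h2 => ?_⟩
      · have : c ∉ S := fun hc => by simpa [hD0] using hmemD c hc hca
        simp [Multiset.count_eq_zero_of_notMem this]
      · simp [hD0] at hcard h2
        omega
    | cons y l =>
      simp only [List.pairwise_cons] at hsort
      refine ⟨by simpa using hsort.1 y (by simp), a, Multiset.mem_dedup.1 ha, by simp,
        fun c hca => ?_, fun _ => ?_⟩
      · by_cases hc : c ∈ S
        · have h1 : S.count c ∈ ((y :: l : List ℕ) : Multiset ℕ) :=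
            hl ▸ Multiset.mem_map_of_mem _ (hmemD c hc hca)
          rcases List.mem_cons.1 (Multiset.mem_coe.1 h1) with h1 | h1
          · simp [h1]
          · simpa using hsort.2.1 _ h1
        · simp [Multiset.count_eq_zero_of_notMem hc]
      · have hy : y ∈ D.map fun a => S.count a := hl ▸ by simp
        obtain ⟨b, hb, hby⟩ := Multiset.mem_map.1 hy
        exact ⟨b, hDS b hb, fun h => hnd.1 (h ▸ hb), by simpa using hby⟩

/-- Removing copies of the most frequent term leaves multiplicities at most `m`. -/
theorem sq_card_sub_le {S : Multiset G} (hS : ZeroSumFree S) {a : G} {m : ℕ}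
    (hm : m ≤ S.count a) (hc : ∀ c, c ≠ a → S.count c ≤ m) :
    (S.card - S.count a + m) * (S.card - S.count a + m) + 6 * m ≤ 6 * m * #(sumFinset S) := by
  have hle : Multiset.replicate (S.count a - m) a ≤ S :=
    Multiset.le_count_iff_replicate_le.1 (Nat.sub_le _ _)
  have h1 := sq_card_le (S := S - Multiset.replicate (S.count a - m) a) (m := m)
    (hS.mono tsub_le_self) (fun c => by
      rw [Multiset.count_sub, Multiset.count_replicate]
      split_ifs with h
      · subst h; omega
      · have := hc c (fun h' => h h'.symm)
        omega)
  rw [Multiset.card_sub hle, Multiset.card_replicate] at h1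
  have h2 := S.count_le_card a
  have h3 : S.card - (S.count a - m) = S.card - S.count a + m := by omega
  rw [h3] at h1
  refine h1.trans (Nat.mul_le_mul_left _ (card_le_card (sumFinset_mono tsub_le_self)))

/-! ### Stable sequences -/

theorem replicate_add_replicate_le {α : Type*} [DecidableEq α] {S : Multiset α} {a b : α}
    (hab : a ≠ b) {p q : ℕ}
    (hp : p ≤ S.count a) (hq : q ≤ S.count b) :
    Multiset.replicate p a + Multiset.replicate q b ≤ S := by
  rw [Multiset.le_iff_count]
  intro c
  rw [Multiset.count_add, Multiset.count_replicate, Multiset.count_replicate]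
  split_ifs with h1 h2 h2
  · exact absurd (h1.trans h2.symm) hab
  · subst h1; omega
  · subst h2; omega
  · omega

theorem ZeroSumFree.eq_zero_of_nsmul_add_nsmul {S : Multiset G} (hS : ZeroSumFree S) {a b : G}
    (hab : a ≠ b) {p q : ℕ} (hp : p ≤ S.count a) (hq : q ≤ S.count b)
    (h : p • a + q • b = 0) : p = 0 ∧ q = 0 := by
  by_contra hne
  refine hS _ (replicate_add_replicate_le hab hp hq) ?_ (by simpa using h)
  intro h0
  have := congrArg Multiset.card h0
  simp at this
  exact hne this

/-- In a stable sequence, a coincidence `i a + j b = i' a + j' b` with `j < j'` gives a relation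
`u a = v b` with `u = i - i'` and `v = j' - j`, on which the transfer operation is possible from
`b` to `a` if `v ≤ u` and from `a` to `b` otherwise. -/
theorem Stable.le_of_nsmul_add_nsmul_eq {S : Multiset G} (hst : Stable S)
    (hS : ZeroSumFree S) {a b : G}
    (ha : a ∈ S) (hb : b ∈ S) (hab : a ≠ b) (hle : S.count b ≤ S.count a) {i i' j j' : ℕ}
    (hi : i ≤ S.count a) (hi' : i' ≤ S.count a) (hj' : j' < S.count b)
    (h : i • a + j • b = i' • a + j' • b) : j' ≤ j := by
  by_contra! hjj
  by_cases hii : i ≤ i'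
  · have := hS.eq_zero_of_nsmul_add_nsmul hab (p := i' - i) (q := j' - j) (by omega) (by omega) (by
      rw [sub_nsmul _ hii, sub_nsmul _ hjj.le, ← sub_eq_add_neg, ← sub_eq_add_neg,
        sub_add_sub_comm, h, sub_self])
    omega
  · have huv : (i - i') • a = (j' - j) • b := by
      rw [sub_nsmul _ (not_le.1 hii).le, sub_nsmul _ hjj.le, ← sub_eq_add_neg, ← sub_eq_add_neg,
        sub_eq_sub_iff_add_eq_add, h, add_comm]
    by_cases hlt : j' - j ≤ i - i'
    · exact hst a ha b hb hab ⟨i - i', j' - j, by omega, by omega, by omega, by omega, huv,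
        by omega⟩
    · exact hst b hb a ha hab.symm ⟨j' - j, i - i', by omega, by omega, by omega, by omega,
        huv.symm, by omega⟩

/-- If `b` is not more frequent than `a` in a stable sequence, then the sums `i a + j b` with
`i ≤ ν(a)` and `j < ν(b)` are distinct. -/
theorem Stable.mul_le_card_sumFinset {S : Multiset G} (hst : Stable S) (hS : ZeroSumFree S)
    {a b : G} (ha : a ∈ S) (hb : b ∈ S) (hab : a ≠ b) (hle : S.count b ≤ S.count a) :
    (S.count a + 1) * S.count b ≤ #(sumFinset (Multiset.replicate (S.count a) a +
      Multiset.replicate (S.count b - 1) b)) := by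
  have hcard : (S.count a + 1) * S.count b = #(range (S.count a + 1) ×ˢ range (S.count b)) := by
    simp
  rw [hcard]
  refine card_le_card_of_injOn (fun x => x.1 • a + x.2 • b) ?_ ?_
  · rintro ⟨i, j⟩ hij
    simp only [coe_product, coe_range, Set.mem_prod, Set.mem_Iio] at hij
    refine mem_sumFinset.2 ⟨Multiset.replicate i a + Multiset.replicate j b,
      add_le_add (Multiset.replicate_le_replicate a |>.2 (by omega))
        (Multiset.replicate_le_replicate b |>.2 (by omega)), by simp⟩
  · rintro ⟨i, j⟩ hij ⟨i', j'⟩ hij' h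
    simp only [coe_product, coe_range, Set.mem_prod, Set.mem_Iio] at hij hij' h
    have h1 := hst.le_of_nsmul_add_nsmul_eq hS ha hb hab hle (by omega) (by omega) hij'.2 h
    have h2 := hst.le_of_nsmul_add_nsmul_eq hS ha hb hab hle (by omega) (by omega) hij.2 h.symm
    obtain rfl : j = j' := le_antisymm h2 h1
    have h3 : i • a = i' • a := add_right_cancel h
    have key : ∀ p q : ℕ, p ≤ q → q ≤ S.count a → p • a = q • a → p = q := by
      intro p q hpq hq hpq'
      have := hS.eq_zero_of_nsmul_add_nsmul hab (p := q - p) (q := 0) (by omega) (by omega) (by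
        rw [sub_nsmul _ hpq, hpq']; simp)
      omega
    rcases le_total i i' with hii | hii
    · rw [key i i' hii (by omega) h3]
    · rw [key i' i hii (by omega) h3.symm]

/-- Each of the terms other than the copies of `a` and of `b` that enter the previous bound adds at
least one more sum. -/
theorem Stable.le_card_sumFinset {S : Multiset G} (hst : Stable S) (hS : ZeroSumFree S)
    {a b : G} (ha : a ∈ S) (hb : b ∈ S) (hab : a ≠ b) (hle : S.count b ≤ S.count a) :
    (S.count b - 1) * S.count a + S.card + 1 ≤ #(sumFinset S) := by
  have h1 := hst.mul_le_card_sumFinset hS ha hb hab hle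
  have hsub := replicate_add_replicate_le hab (le_refl (S.count a)) (Nat.sub_le (S.count b) 1)
  set U := Multiset.replicate (S.count a) a + Multiset.replicate (S.count b - 1) b with hU
  have hUS : U + (S - U) = S := add_tsub_cancel_of_le hsub
  have h2 := card_sumFinset_add (hUS.symm ▸ hS)
  have h3 := card_lt_card_sumFinset (hS.mono (tsub_le_self : S - U ≤ S))
  rw [hUS] at h2
  have hUc : U.card = S.count a + (S.count b - 1) := by simp [hU]
  have h4 := Multiset.card_le_card hsub
  rw [Multiset.card_sub hsub] at h3
  have hb1 := Multiset.count_pos.2 hb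
  obtain ⟨m, hm⟩ : ∃ m, S.count b = m + 1 := ⟨S.count b - 1, by omega⟩
  rw [hm, Nat.add_sub_cancel] at hUc ⊢
  rw [hm] at h1
  have h5 : (S.count a + 1) * (m + 1) = m * S.count a + S.count a + m + 1 := by ring
  omega

/-! ### Real inequalities -/

/-- If `m = h₂` were at least `C`, then first `h₁ = x > n / (6 C)` would give `m < 6 C ^ 2`, then
`x > n / 4` would give `m < 4 C`, which is small enough for the lower bound `(m - 1) x + n + 1` for
the number of sums to be incompatible with the upper one. -/
theorem lt_of_card_bounds {C n x m σ : ℕ} (hC : 2 ≤ C) (hn : (4 * C) ^ 3 ≤ n) (hxn : x ≤ n)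
    (h1 : n * n ≤ 6 * x * σ) (h2 : (n - x + m) * (n - x + m) ≤ 6 * m * σ)
    (h3 : (m - 1) * x + n + 1 ≤ σ)
    (hσ : (σ : ℝ) < (C : ℝ) * (n : ℝ) - (C : ℝ) ^ 2 * √(6 * (n : ℝ))) : m < C := by
  by_contra! hmC
  have hr0 := Real.sqrt_nonneg (6 * (n : ℝ))
  have hr := Real.sq_sqrt (show (0 : ℝ) ≤ 6 * (n : ℝ) by positivity)
  set r := √(6 * (n : ℝ))
  have hC' : (2 : ℝ) ≤ C := by exact_mod_cast hC
  have hn' : (64 : ℝ) * (C : ℝ) ^ 3 ≤ n := by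
    have : ((4 * C : ℝ)) ^ 3 ≤ n := by exact_mod_cast hn
    nlinarith
  have hn0 : (0 : ℝ) < n := lt_of_lt_of_le (by positivity) hn'
  have hx' : (x : ℝ) ≤ n := by exact_mod_cast hxn
  have hmC' : (C : ℝ) ≤ m := by exact_mod_cast hmC
  have hm0 : (0 : ℝ) < m := by linarith
  have h1' : (n : ℝ) * n ≤ 6 * x * σ := by exact_mod_cast h1
  have h2' : ((n : ℝ) - x + m) * ((n : ℝ) - x + m) ≤ 6 * m * σ := by
    rw [← Nat.cast_sub hxn]; exact_mod_cast h2
  have h3' : ((m : ℝ) - 1) * x + n + 1 ≤ σ := by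
    have : ((m - 1 : ℕ) : ℝ) = (m : ℝ) - 1 := by rw [Nat.cast_sub (by omega)]; simp
    rw [← this]; exact_mod_cast h3
  have hσ' : (σ : ℝ) < C * n := by linarith [mul_nonneg (sq_nonneg (C : ℝ)) hr0]
  have hx0 : (0 : ℝ) < x := by
    rcases Nat.eq_zero_or_pos x with h | h
    · subst h; simp at h1'; nlinarith
    · exact_mod_cast h
  have hnx : (n : ℝ) < 6 * x * C := by
    have : (n : ℝ) * n < (6 * x * C) * n := by
      linarith [mul_lt_mul_of_pos_left hσ' hx0]
    exact lt_of_mul_lt_mul_right this hn0.le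
  have hmx : (m : ℝ) * x < C * n := by linarith
  have hm1 : (m : ℝ) < 6 * C ^ 2 := by
    have : (m : ℝ) * x < (6 * C ^ 2) * x := by
      linarith [mul_lt_mul_of_pos_left hnx (by linarith : (0 : ℝ) < C)]
    exact lt_of_mul_lt_mul_right this hx0.le
  have hy0 : 0 ≤ (n : ℝ) - x + m := by linarith
  set y := (n : ℝ) - x + m with hy
  have hy1 : y * y < 6 * m * (C * n) := by linarith [mul_lt_mul_of_pos_left hσ' hm0]
  have hy2 : y < 3 / 4 * n := by
    have h4 : 6 * m * (C * n) ≤ 36 * C ^ 3 * (n : ℝ) := by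
      have : (m : ℝ) * (C * n) ≤ 6 * C ^ 2 * (C * n) := by gcongr
      linarith
    have h5 : 36 * C ^ 3 * (n : ℝ) ≤ (3 / 4 * n) * (3 / 4 * n) := by
      linarith [mul_le_mul_of_nonneg_right hn' hn0.le]
    exact lt_of_mul_self_lt_mul_self₀ (by positivity) (by linarith)
  have hm4 : (m : ℝ) < 4 * C := by
    have hx4 : (n : ℝ) < 4 * x := by linarith
    have : (m : ℝ) * x < (4 * C) * x := by
      linarith [mul_lt_mul_of_pos_left hx4 (by linarith : (0 : ℝ) < C)]
    exact lt_of_mul_lt_mul_right this hx0.le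
  -- By the inequality of the means, `√(m C) ≤ (C + m) / 2`.
  have hy3 : y < r * (C + m) / 2 := by
    have h4 : y * y < (r * (C + m) / 2) * (r * (C + m) / 2) := by
      have : (r * (C + m) / 2) * (r * (C + m) / 2) - 6 * m * (C * n) = r ^ 2 * ((C - m) / 2) ^ 2 +
          (r ^ 2 - 6 * n) * (m * C) := by ring
      rw [hr, sub_self, zero_mul, add_zero] at this
      have : 0 ≤ 6 * (n : ℝ) * ((C - m) / 2) ^ 2 := by positivity
      linarith
    exact lt_of_mul_self_lt_mul_self₀ (by positivity) h4
  have hx5 : (n : ℝ) - r * (C + m) / 2 ≤ x := by linarith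
  have h6 : ((m : ℝ) - 1) * (n - r * (C + m) / 2) ≤ (m - 1) * x :=
    mul_le_mul_of_nonneg_left hx5 (by linarith)
  obtain ⟨d, hd⟩ : ∃ d, m = C + d := ⟨m - C, by omega⟩
  have hmd : (m : ℝ) = C + d := by rw [hd]; push_cast; rfl
  have hd0 : (0 : ℝ) ≤ d := by positivity
  rw [hmd] at h6 h3' hm4
  have h7 : (d : ℝ) * n < r * (3 * C * d + d * d - 2 * C - d) / 2 := by linarith
  have h8 : (d : ℝ) * n < d * (3 * C * r) := by
    have h9 : r * (d * d) ≤ r * (d * (3 * C)) := by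
      gcongr
      linarith
    have h10 : 0 ≤ r * C := by positivity
    linarith [mul_nonneg hr0 hd0]
  have h9 : (n : ℝ) < 3 * C * r := lt_of_mul_lt_mul_left h8 hd0
  have h10 : (n : ℝ) * n < 54 * C ^ 2 * n := by
    have h11 : (n : ℝ) * n < (3 * C * r) * (3 * C * r) := mul_self_lt_mul_self hn0.le h9
    have h12 : (3 * C * r) * (3 * C * r) = 9 * C ^ 2 * r ^ 2 := by ring
    rw [h12, hr] at h11
    linarith
  have h11 : (n : ℝ) < 54 * C ^ 2 := lt_of_mul_lt_mul_right h10 hn0.le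
  have h12 : (2 : ℝ) * C ^ 2 ≤ C * C ^ 2 := mul_le_mul_of_nonneg_right hC' (sq_nonneg _)
  linarith [sq_nonneg (C : ℝ)]

end GroupSequence

open GroupSequence in
theorem mainTheorem2 {G : Type*} [AddCommGroup G] [DecidableEq G] (C : ℕ) (hC : 2 ≤ C)
    (S : Multiset G) (hS : GroupSequence.ZeroSumFree S) (n h₁ h₂ σ : ℕ)
    (hn : n = S.card) (hn2 : 2 ≤ n)
    (hh₁ : h₁ = GroupSequence.kthMult 1 S) (hh₂ : h₂ = GroupSequence.kthMult 2 S)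
    (hσ : σ = (GroupSequence.subsums S).ncard) (hσC : σ < C * n) :
    ((n : ℝ) ^ 2 / (6 * (σ : ℝ)) < (h₁ : ℝ) ∧
      (n : ℝ) / (6 * (C : ℝ)) < (n : ℝ) ^ 2 / (6 * (σ : ℝ))) ∧
    (2 ≤ S.toFinset.card →
      (n : ℝ) - √(6 * (h₂ : ℝ) * (σ : ℝ)) + (h₂ : ℝ) < (h₁ : ℝ) ∧
      (n : ℝ) - √(6 * (C : ℝ) * (n : ℝ) * (h₂ : ℝ)) + (h₂ : ℝ) <
        (n : ℝ) - √(6 * (h₂ : ℝ) * (σ : ℝ)) + (h₂ : ℝ)) ∧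
    (GroupSequence.Stable S → (4 * C) ^ 3 ≤ n →
      (σ : ℝ) < (C : ℝ) * (n : ℝ) - (C : ℝ) ^ 2 * √(6 * (n : ℝ)) →
      (h₂ : ℝ) ≤ (C : ℝ) - 1 ∧
      (n : ℝ) - (C : ℝ) * √(6 * (n : ℝ)) + 1 < (h₁ : ℝ)) := by
  have hS0 : S ≠ 0 := by
    rintro rfl
    simp at hn
    omega
  obtain ⟨h21, a, haS, ha, hc, hb⟩ := exists_count_eq_kthMult hS0
  rw [ncard_subsums] at hσ
  have key1 := sq_card_le hS (m := h₁) (fun c => by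
    by_cases h : c = a
    · rw [h, ha, hh₁]
    · have := hc c h
      omega)
  have key2 := sq_card_sub_le hS (a := a) (m := h₂) (by omega) (fun c h => hh₂ ▸ hc c h)
  have hxn := S.count_le_card a
  have ha0 := Multiset.count_pos.2 haS
  rw [ha, ← hh₁, ← hn] at hxn
  rw [ha, ← hh₁] at ha0
  rw [ha, ← hh₁, ← hn, ← hσ] at key2
  rw [← hn, ← hσ] at key1
  have hσ0 : 0 < σ := hσ ▸ card_sumFinset_pos S
  have hσ0' : (0 : ℝ) < σ := by exact_mod_cast hσ0
  have hn0 : (0 : ℝ) < n := by exact_mod_cast (by omega : 0 < n)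
  have hC0 : (0 : ℝ) < C := by exact_mod_cast (by omega : 0 < C)
  have hσC' : (σ : ℝ) < C * n := by exact_mod_cast hσC
  have hsecond : 0 < h₂ → (n : ℝ) - √(6 * (h₂ : ℝ) * (σ : ℝ)) + (h₂ : ℝ) < (h₁ : ℝ) ∧
      (n : ℝ) - √(6 * (C : ℝ) * (n : ℝ) * (h₂ : ℝ)) + (h₂ : ℝ) <
        (n : ℝ) - √(6 * (h₂ : ℝ) * (σ : ℝ)) + (h₂ : ℝ) := by
    intro hpos
    have hpos' : (0 : ℝ) < h₂ := by exact_mod_cast hpos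
    constructor
    · have h1 : ((n : ℝ) - h₁ + h₂) ^ 2 < 6 * h₂ * σ := by
        have : (n - h₁ + h₂) * (n - h₁ + h₂) < 6 * h₂ * σ := by omega
        rw [← Nat.cast_sub hxn, sq]
        exact_mod_cast this
      have := Real.lt_sqrt_of_sq_lt h1
      linarith
    · have : √(6 * (h₂ : ℝ) * (σ : ℝ)) < √(6 * (C : ℝ) * (n : ℝ) * (h₂ : ℝ)) :=
        Real.sqrt_lt_sqrt (by positivity) (by nlinarith)
      linarith
  refine ⟨⟨?_, ?_⟩, fun h2 => ?_, fun hst hnC hσ' => ?_⟩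
  · rw [div_lt_iff₀ (by positivity)]
    have : n * n < h₁ * (6 * σ) := by nlinarith
    rw [sq]
    exact_mod_cast this
  · rw [div_lt_div_iff₀ (by positivity) (by positivity)]
    nlinarith
  · obtain ⟨b, hbS, -, hb'⟩ := hb (Or.inl h2)
    exact hsecond (by rw [hh₂, ← hb']; exact Multiset.count_pos.2 hbS)
  · have hr0 : 0 < √(6 * (n : ℝ)) := Real.sqrt_pos.2 (by positivity)
    have hlt : h₂ < C := by
      rcases Nat.eq_zero_or_pos h₂ with h0 | hpos
      · omega
      · obtain ⟨b, hbS, hba, hb'⟩ := hb (Or.inr (hh₂ ▸ hpos))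
        have h3 := hst.le_card_sumFinset hS haS hbS hba.symm (by omega)
        rw [ha, hb', ← hh₁, ← hh₂, ← hn, ← hσ] at h3
        exact lt_of_card_bounds hC hnC hxn (by omega) (by omega) h3 hσ'
    have hlt' : (h₂ : ℝ) ≤ C - 1 := by
      have : ((h₂ + 1 : ℕ) : ℝ) ≤ C := by exact_mod_cast hlt
      push_cast at this
      linarith
    refine ⟨hlt', ?_⟩
    rcases Nat.eq_zero_or_pos h₂ with h0 | hpos
    -- A single distinct term.
    · have h4 : h₁ = n := by
        subst h0
        simp at key2
        omega
      have hC2 : (2 : ℝ) ≤ C := by exact_mod_cast hC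
      have : 1 ≤ √(6 * (n : ℝ)) := Real.one_le_sqrt.2 (by
        have : (2 : ℝ) ≤ n := by exact_mod_cast hn2
        linarith)
      rw [h4]
      nlinarith
    · obtain ⟨h3, h4⟩ := hsecond hpos
      have h5 : √(6 * (C : ℝ) * (n : ℝ) * (h₂ : ℝ)) ≤ C * √(6 * (n : ℝ)) := by
        rw [Real.sqrt_le_left (by positivity), mul_pow, Real.sq_sqrt (by positivity)]
        have : 6 * (C : ℝ) * n * h₂ ≤ 6 * C * n * C := by
          gcongr
        linarith
      have h6 : (1 : ℝ) ≤ h₂ := by exact_mod_cast hpos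
      linarith
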